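/- **Theorem 3.1.** Let $X$ be a (real or complex) Banach space with norm $\|\cdot\|$ and with a Schauder basis $(e_i)_{i=1}^\infty$. Suppose that $X$ is *sequentially arbitrarily distortable*, that is, there are equivalent norms $\|\cdot\|_i\le\|\cdot\|$ $(i\in\mathbb N)$ on $X$ and reals $\varepsilon_i\downarrow 0$ such that for every closed infinite dimensional linear subspace $Y$ of $X$ and every $i_0\in\mathbb N$ there is $y\in Y$ with $\|y\|_{i_0}=1$ and $\|y\|_i\le\varepsilon_{\min(i,i_0)}$ for all $i\ne i_0$. Then for every $n\in\mathbb N$ and $\varepsilon>0$ there is an equivalent norm $|\cdot|$ on $X$ with the following property. If $(y_i)_{i=1}^n$ is any monotone basis of any $n$-dimensional Banach space $F$ (that is, $\|\sum_{i\le m}a_iy_i\|\le\|\sum_{i\le n}a_iy_i\|$ for all scalars $a_1,\dots,a_n$ and all $m\le n$), then every block basis $(u_j)_{j=1}^\infty$ of $(e_i)$ has a further finite block basis $(x_i)_{i=1}^n$ such that $(x_i)_{i=1}^n$ in $(X,|\cdot|)$ is $(1+\varepsilon)$-equivalent to $(y_i)_{i=1}^n$; that is, there are $A,B>0$ with $AB\le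 1+\varepsilon$ and $$A^{-1}\Big\|\sum_{i=1}^n a_iy_i\Big\|\le\Big|\sum_{i=1}^n a_ix_i\Big|\le B\Big\|\sum_{i=1}^n a_iy_i\Big\|\qquad\text{for all scalars }a_1,\dots,a_n.$$ Here a (finite or infinite) block basis of a sequence consists of nonzero finite linear combinations of its terms, taken over successive disjoint finite sets of indices. -/

import Mathlib

/-- `p` is an equivalent norm on the normed space `X`. (The lower bound makes the seminorm `p`
a norm.) -/
def IsEquivalentNorm {𝕜 X : Type*} [RCLike 𝕜] [NormedAddCommGroup X] [NormedSpace 𝕜 X]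
    (p : Seminorm 𝕜 X) : Prop :=
  ∃ c C : ℝ, 0 < c ∧ 0 < C ∧ ∀ x : X, c * ‖x‖ ≤ p x ∧ p x ≤ C * ‖x‖

/-- `X` is sequentially arbitrarily distortable: there are equivalent norms `p i ≤ ‖·‖` and
`ε i ↓ 0` such that every closed infinite dimensional linear subspace `Y` contains, for every
index `i₀`, a vector `y` with `p i₀ y = 1` and `p i y ≤ ε (min i i₀)` for all `i ≠ i₀`. -/
def SequentiallyArbitrarilyDistortable (𝕜 X : Type*) [RCLike 𝕜] [NormedAddCommGroup X]
    [NormedSpace 𝕜 X] : Prop :=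
  ∃ (p : ℕ → Seminorm 𝕜 X) (ε : ℕ → ℝ),
    (∀ i, IsEquivalentNorm (p i)) ∧
    Antitone ε ∧ Filter.Tendsto ε Filter.atTop (nhds 0) ∧
    (∀ i x, p i x ≤ ‖x‖) ∧
    ∀ Y : Submodule 𝕜 X, IsClosed (Y : Set X) → ¬ FiniteDimensional 𝕜 Y →
      ∀ i₀ : ℕ, ∃ y ∈ Y, p i₀ y = 1 ∧ ∀ i, i ≠ i₀ → p i y ≤ ε (min i i₀)

/-- `u` is a block basis of the sequence `e`: each `u j` is a nonzero linear combination of finitely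
many of the `e i`, and the blocks of indices used are successive. The index set `ι` is `ℕ` for an
(infinite) block basis, and `Fin n` for a finite block basis of length `n`. -/
def IsBlockBasis (𝕜 : Type*) {X ι : Type*} [RCLike 𝕜] [NormedAddCommGroup X] [NormedSpace 𝕜 X]
    [LT ι] (e : ℕ → X) (u : ι → X) : Prop :=
  ∃ s : ι → Finset ℕ,
    (∀ j k, j < k → ∀ a ∈ s j, ∀ b ∈ s k, a < b) ∧
    ∀ j, u j ≠ 0 ∧ u j ∈ Submodule.span 𝕜 (e '' (s j : Set ℕ))

/-- The basis `y` of the `n`-dimensional normed space `F` is monotone: the natural projections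
`∑ i, a i • y i ↦ ∑ i < m, a i • y i` have norm at most one. -/
def IsMonotoneBasis {𝕜 F : Type*} [RCLike 𝕜] [NormedAddCommGroup F] [NormedSpace 𝕜 F] {n : ℕ}
    (y : Module.Basis (Fin n) 𝕜 F) : Prop :=
  ∀ (a : Fin n → 𝕜) (m : ℕ),
    ‖∑ i : Fin n with i.val < m, a i • y i‖ ≤ ‖∑ i, a i • y i‖

/-- The finite sequences `x` in `(X, q)` and `y` in `(F, ‖·‖)` are `C`-equivalent: the linear map
`T` with `T (y i) = x i` is invertible between the linear spans, with `‖T⁻¹‖ ≤ A`, `‖T‖ ≤ B`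
for some `A`, `B` with `A * B ≤ C`. -/
def AreEquivalentWithConstant {𝕜 X F : Type*} [RCLike 𝕜] [NormedAddCommGroup X]
    [NormedSpace 𝕜 X] [NormedAddCommGroup F] [NormedSpace 𝕜 F] {n : ℕ}
    (C : ℝ) (q : Seminorm 𝕜 X) (x : Fin n → X) (y : Fin n → F) : Prop :=
  ∃ A B : ℝ, 0 < A ∧ 0 < B ∧ A * B ≤ C ∧
    ∀ a : Fin n → 𝕜,
      ‖∑ i, a i • y i‖ ≤ A * q (∑ i, a i • x i) ∧
      q (∑ i, a i • x i) ≤ B * ‖∑ i, a i • y i‖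

/-! The new norm is `p K` plus a supremum over the branches of a coded tree. Normalized monotone
norms on `𝕜ⁿ` form a separable family, so countably many labels m suffice. A node is a label with a
finite sequence of naturals, coded injectively as the index of one norm `p i`; the next term of the
sequence selects a functional from a list norming that `p i`.

Given a block basis and a label m, pick vectors z_l in its successive blocks, each normalized for
the norm coded by the current node and small for the others, and let the branch continue with a
functional almost norming z_l. The matrix of any branch with label m on (z_l) is then almost the
identity cut at the node r where it leaves this branch, except for one entry at r of modulus about 1
at most; other labels give almost zero. Pairing sums of N functionals with averages of N vectors
shrinks the exceptional entry to 1/N and turns the cut into an average of initial projections of the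
coefficients, which monotonicity controls. So the supremum is nearly attained on the branch
followed, with value nearly m. -/

open Set Filter Topology

/-! ### Norming functionals and small vectors in tails. -/

/-- Each of a family of seminorms dominated by the norm of a separable space is approximately
normed by countably many linear functionals. -/
theorem exists_norming_sequence {𝕜 X : Type*} [RCLike 𝕜] [NormedAddCommGroup X] [NormedSpace 𝕜 X]
    [TopologicalSpace.SeparableSpace X] (p : ℕ → Seminorm 𝕜 X) (hp : ∀ i x, p i x ≤ ‖x‖) :
    ∃ f : ℕ → ℕ → X →ₗ[𝕜] 𝕜, (∀ k j x, ‖f k j x‖ ≤ p k x) ∧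
      ∀ k z δ, 0 < δ → ∃ j, ‖f k j z - (p k z : 𝕜)‖ ≤ δ := by
  have key : ∀ (k : ℕ) (d : X), ∃ g : X →ₗ[𝕜] 𝕜, (∀ x, ‖g x‖ ≤ p k x) ∧ g d = (p k d : 𝕜) := by
    intro k d
    by_cases hd : d = 0
    · exact ⟨0, fun x => by simp, by simp [hd]⟩
    · let φ : Module.Dual 𝕜 (𝕜 ∙ d) :=
        (p k d : 𝕜) • (LinearEquiv.toSpanNonzeroSingleton 𝕜 X d hd).symm.toLinearMap
      have hφ : ∀ c : 𝕜, ∀ h, φ ⟨c • d, h⟩ = (p k d : 𝕜) * c := by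
        intro c h
        have : (⟨c • d, h⟩ : 𝕜 ∙ d) = LinearEquiv.toSpanNonzeroSingleton 𝕜 X d hd c := rfl
        rw [this, LinearMap.smul_apply, LinearEquiv.coe_coe, LinearEquiv.symm_apply_apply,
          smul_eq_mul]
      obtain ⟨g, hg, hgp⟩ := Module.Dual.exists_extension_of_le_seminorm (𝕜 ∙ d) φ (p := p k) (by
        rintro ⟨x, hx⟩
        obtain ⟨c, rfl⟩ := Submodule.mem_span_singleton.1 hx
        rw [hφ]
        simp [map_smul_eq_mul, mul_comm, abs_of_nonneg (apply_nonneg (p k) d)])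
      refine ⟨g, hgp, ?_⟩
      have h1 : (1 : 𝕜) • d ∈ 𝕜 ∙ d := Submodule.mem_span_singleton.2 ⟨1, rfl⟩
      have := hg ⟨(1 : 𝕜) • d, h1⟩
      rw [hφ 1 h1] at this
      simpa using this
  obtain ⟨d, hd⟩ := TopologicalSpace.exists_dense_seq X
  choose g hg hgd using key
  refine ⟨fun k j => g k (d j), fun k j x => hg _ _ _, fun k z δ hδ => ?_⟩
  obtain ⟨j, hj⟩ := hd.exists_dist_lt z (half_pos hδ)
  refine ⟨j, ?_⟩
  rw [dist_eq_norm] at hj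
  have h1 : ‖g k (d j) (z - d j)‖ ≤ δ / 2 := ((hg _ _ _).trans (hp _ _)).trans hj.le
  have h2 : ‖((p k (d j) - p k z : ℝ) : 𝕜)‖ ≤ δ / 2 := by
    rw [RCLike.norm_ofReal]
    refine (abs_sub_map_le_sub (p k) (d j) z).trans ?_
    rw [map_sub_rev]
    exact (hp _ _).trans hj.le
  have h3 : g k (d j) z - (p k z : 𝕜)
      = g k (d j) (z - d j) + ((p k (d j) - p k z : ℝ) : 𝕜) := by
    rw [map_sub, hgd]; push_cast; ring
  rw [h3]
  exact (norm_add_le _ _).trans (by linarith)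

theorem SchauderBasis.separableSpace {𝕜 X : Type*} [RCLike 𝕜] [NormedAddCommGroup X]
    [NormedSpace 𝕜 X] (e : SchauderBasis 𝕜 X) : TopologicalSpace.SeparableSpace X := by
  have h : closure (Submodule.span 𝕜 (range e.basis) : Set X) = univ := by
    refine eq_univ_of_forall fun x => mem_closure_of_tendsto (e.expansion x) ?_
    exact Eventually.of_forall fun A => Submodule.sum_mem _ fun i _ =>
      Submodule.smul_mem _ _ (Submodule.subset_span ⟨i, rfl⟩)
  rw [← TopologicalSpace.isSeparable_univ_iff, ← h]
  exact ((countable_range _).isSeparable.span (R := 𝕜)).closure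

theorem IsBlockBasis.linearIndependent {𝕜 X ι : Type*} [RCLike 𝕜] [NormedAddCommGroup X]
    [NormedSpace 𝕜 X] [LinearOrder ι] {e : ℕ → X} (he : LinearIndependent 𝕜 e) {u : ι → X}
    (hu : IsBlockBasis 𝕜 e u) : LinearIndependent 𝕜 u := by
  obtain ⟨s, hs, hus⟩ := hu
  refine iSupIndep.linearIndependent (fun j => Submodule.span 𝕜 (e '' (s j : Set ℕ))) ?_
    (fun j => (hus j).2) (fun j => (hus j).1)
  intro i
  have : (⨆ j, ⨆ (_ : j ≠ i), Submodule.span 𝕜 (e '' (s j : Set ℕ)))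
      = Submodule.span 𝕜 (e '' ⋃ j, ⋃ (_ : j ≠ i), (s j : Set ℕ)) := by
    simp only [image_iUnion, Submodule.span_iUnion]
  rw [this]
  refine he.disjoint_span_image ?_
  simp only [disjoint_iUnion_right]
  intro j hj
  rw [Set.disjoint_left]
  intro a ha hb
  rcases lt_or_gt_of_ne hj with h | h
  · exact lt_irrefl _ (hs j i h a hb a ha)
  · exact lt_irrefl _ (hs i j h a ha a hb)

/-- In a sequentially arbitrarily distorted space, the tails of a linearly independent sequence have
finite linear combinations that are normalized for one of the norms and small for the others. -/
theorem exists_finite_combination_small {𝕜 X : Type*} [RCLike 𝕜] [NormedAddCommGroup X]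
    [NormedSpace 𝕜 X] {p : ℕ → Seminorm 𝕜 X} {ε : ℕ → ℝ} (hε : Antitone ε)
    (hp : ∀ i x, p i x ≤ ‖x‖)
    (hY : ∀ Y : Submodule 𝕜 X, IsClosed (Y : Set X) → ¬ FiniteDimensional 𝕜 Y →
      ∀ i₀ : ℕ, ∃ y ∈ Y, p i₀ y = 1 ∧ ∀ i, i ≠ i₀ → p i y ≤ ε (min i i₀))
    {u : ℕ → X} (hu : LinearIndependent 𝕜 u) {δ : ℝ} (hδ : 0 < δ) {K : ℕ} (hK : ε K ≤ δ / 4)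
    (k : ℕ) (hk : K ≤ k) (M : ℕ) :
    ∃ M' ≥ M, ∃ z ∈ Submodule.span 𝕜 (u '' Ico M M'), p k z = 1 ∧
      ∀ i, K ≤ i → i ≠ k → p i z ≤ δ := by
  set W := Submodule.span 𝕜 (u '' Ici M) with hW
  have hinf : ¬ FiniteDimensional 𝕜 W.topologicalClosure := by
    intro hfin
    let v : ℕ → W.topologicalClosure := fun i => ⟨u (M + i),
      W.le_topologicalClosure (Submodule.subset_span ⟨M + i, by simp, rfl⟩)⟩
    have hv : LinearIndependent 𝕜 v := by
      apply LinearIndependent.of_comp W.topologicalClosure.subtype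
      exact hu.comp (fun i => M + i) (add_right_injective M)
    exact Module.Finite.not_linearIndependent_of_infinite v hv
  obtain ⟨y, hy, hy1, hyi⟩ := hY _ W.isClosed_topologicalClosure hinf k
  -- The approximant w has `p k w ≥ 1/2` and `p i w ≤ δ/2`, so normalizing it costs at most a factor
  -- 2.
  set η := min (1 / 2) (δ / 4) with hη
  have hη0 : 0 < η := lt_min (by norm_num) (by linarith)
  have hη1 : η ≤ 1 / 2 := min_le_left _ _
  have hη2 : η ≤ δ / 4 := min_le_right _ _
  obtain ⟨w, hw, hwy⟩ := Metric.mem_closure_iff.1 (show y ∈ closure (W : Set X) from hy) η hη0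
  rw [dist_eq_norm] at hwy
  have hdiff : ∀ i, |p i w - p i y| ≤ η := fun i => by
    refine (abs_sub_map_le_sub (p i) w y).trans ?_
    rw [map_sub_rev]
    exact (hp _ _).trans hwy.le
  have hkw : 1 / 2 ≤ p k w := by
    have := (abs_le.1 (hdiff k)).1
    rw [hy1] at this
    linarith
  have hkw0 : 0 < p k w := by linarith
  obtain ⟨l, hl, rfl⟩ := (Finsupp.mem_span_image_iff_linearCombination 𝕜).1 hw
  set w := Finsupp.linearCombination 𝕜 u l with hwdef
  have hnorm : ‖((p k w : ℝ) : 𝕜)⁻¹‖ = (p k w)⁻¹ := by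
    rw [norm_inv, RCLike.norm_ofReal, abs_of_pos hkw0]
  refine ⟨max M (l.support.sup id + 1), le_max_left _ _, ((p k w : ℝ) : 𝕜)⁻¹ • w,
    Submodule.smul_mem _ _ ?_, ?_, ?_⟩
  · refine (Finsupp.mem_span_image_iff_linearCombination 𝕜).2 ⟨l, ?_, rfl⟩
    rw [Finsupp.mem_supported] at hl ⊢
    intro i hi
    refine ⟨hl hi, lt_max_of_lt_right (Nat.lt_succ_of_le ?_)⟩
    exact Finset.le_sup (f := id) hi
  · rw [map_smul_eq_mul, hnorm, inv_mul_cancel₀ hkw0.ne']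
  · intro i hi hik
    rw [map_smul_eq_mul, hnorm, inv_mul_le_iff₀ hkw0]
    have h1 := (abs_le.1 (hdiff i)).2
    have h2 := hyi i hik
    have h3 : ε (min i k) ≤ ε K := hε (le_min hi hk)
    nlinarith

/-! ### Normalized monotone norms on `𝕜ⁿ`. -/

/-- A seminorm on `𝕜ⁿ` for which the unit vectors are a normalized monotone basis. -/
structure Seminorm.IsNormalizedMonotone {𝕜 : Type*} [RCLike 𝕜] {n : ℕ}
    (ν : Seminorm 𝕜 (Fin n → 𝕜)) : Prop where
  single : ∀ i, ν (Pi.single i 1) = 1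
  truncate : ∀ (a : Fin n → 𝕜) (m : ℕ), ν (fun i => if i.val < m then a i else 0) ≤ ν a

namespace Seminorm.IsNormalizedMonotone

variable {𝕜 : Type*} [RCLike 𝕜] {n : ℕ} {ν : Seminorm 𝕜 (Fin n → 𝕜)}

theorem le_sum (hν : ν.IsNormalizedMonotone) (a : Fin n → 𝕜) : ν a ≤ ∑ i, ‖a i‖ := by
  conv_lhs => rw [← Finset.univ_sum_single a]
  refine (Finset.le_sum_of_subadditive ν (map_zero ν).le (map_add_le_add ν) _ _).trans
    (Finset.sum_le_sum fun i _ => ?_)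
  have : Pi.single i (a i) = a i • (Pi.single i 1 : Fin n → 𝕜) := by
    rw [← Pi.single_smul]; simp
  rw [this, map_smul_eq_mul, hν.single, mul_one]

theorem norm_le (hν : ν.IsNormalizedMonotone) (a : Fin n → 𝕜) : ‖a‖ ≤ 2 * ν a := by
  refine (pi_norm_le_iff_of_nonneg (by positivity)).2 fun i => ?_
  -- A coordinate is the difference of two consecutive truncations, hence the factor 2.
  have h : a i • (Pi.single i 1 : Fin n → 𝕜) = (fun j => if j.val < i.val + 1 then a j else 0)
      - (fun j => if j.val < i.val then a j else 0) := by
    ext j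
    rcases lt_trichotomy j i with h | h | h
    · simp [h.ne, h, h.le]
    · subst h; simp
    · simp [h.ne', h.not_ge, h.not_gt]
  have := map_sub_le_add ν (fun j => if j.val < i.val + 1 then a j else 0)
    (fun j => if j.val < i.val then a j else 0)
  rw [← h, map_smul_eq_mul, hν.single, mul_one] at this
  linarith [hν.truncate a (i.val + 1), hν.truncate a i.val]

theorem continuous (hν : ν.IsNormalizedMonotone) : Continuous ν := by
  refine Seminorm.continuous_of_le (q := (n : NNReal) • normSeminorm 𝕜 (Fin n → 𝕜)) ?_ ?_
  · exact (continuous_const (y := (n : NNReal))).smul continuous_norm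
  · intro a
    refine (hν.le_sum a).trans ?_
    refine (Finset.sum_le_sum fun i _ => norm_le_pi_norm a i).trans ?_
    simp [NNReal.smul_def]

/-- Restriction to the compact unit ball embeds these seminorms in a separable space of continuous
functions, whose subsets are separable. The countable set lets one norm on `X` serve every `F`. -/
theorem exists_countable_dense (𝕜 : Type*) [RCLike 𝕜] (n : ℕ) :
    ∃ T : Set (Seminorm 𝕜 (Fin n → 𝕜)), T.Countable ∧ (∀ μ ∈ T, μ.IsNormalizedMonotone) ∧
      ∀ ν : Seminorm 𝕜 (Fin n → 𝕜), ν.IsNormalizedMonotone → ∀ η : ℝ, 0 < η →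
        ∃ μ ∈ T, ∀ a, |ν a - μ a| ≤ η * ‖a‖ := by
  let B := Metric.closedBall (0 : Fin n → 𝕜) 1
  have : CompactSpace B := isCompact_iff_compactSpace.1 (isCompact_closedBall _ _)
  let S := {ν : Seminorm 𝕜 (Fin n → 𝕜) // ν.IsNormalizedMonotone}
  let Φ : S → C(B, ℝ) := fun ν => ⟨fun b => ν.1 b, ν.2.continuous.comp continuous_subtype_val⟩
  obtain ⟨t, htc, htd⟩ := TopologicalSpace.exists_countable_dense (range Φ)
  have hsel : ∀ g : range Φ, ∃ ν : S, Φ ν = g := fun g => g.2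
  choose σ hσ using hsel
  refine ⟨(fun g => (σ g).1) '' t, htc.image _, ?_, ?_⟩
  · rintro _ ⟨g, -, rfl⟩
    exact (σ g).2
  · intro ν hν η hη
    obtain ⟨g, hg, hgd⟩ := htd.exists_dist_lt ⟨Φ ⟨ν, hν⟩, mem_range_self _⟩ hη
    refine ⟨_, ⟨g, hg, rfl⟩, fun a => ?_⟩
    have hB : ∀ b : B, |ν b - (σ g).1 b| ≤ η := by
      intro b
      have h1 := ContinuousMap.dist_apply_le_dist (f := Φ ⟨ν, hν⟩) (g := (g : C(B, ℝ))) b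
      rw [← hσ g, Real.dist_eq] at h1
      refine h1.trans ?_
      rw [hσ g]
      exact hgd.le
    by_cases ha : a = 0
    · simp [ha]
    · have ha0 : 0 < ‖a‖ := norm_pos_iff.2 ha
      have hn : ‖((‖a‖ : ℝ) : 𝕜)⁻¹‖ = ‖a‖⁻¹ := by simp
      have := hB ⟨((‖a‖ : ℝ) : 𝕜)⁻¹ • a, by
        simp only [B, mem_closedBall_zero_iff, norm_smul, hn]
        exact (inv_mul_cancel₀ ha0.ne').le⟩
      simp only [map_smul_eq_mul, hn, ← mul_sub, abs_mul, abs_inv, abs_norm] at this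
      rwa [inv_mul_le_iff₀ ha0, mul_comm] at this

end Seminorm.IsNormalizedMonotone

/-! ### Coded tree of norms and functionals. -/

/-- The index of the norm attached to the `l`-th node of the branch `j` of the tree of finite
sequences of natural numbers labelled by `m`. -/
def branchCode {ι : Type*} [Encodable ι] (K : ℕ) (m : ι) (j : ℕ → ℕ) (l : ℕ) : ℕ :=
  K + 1 + Encodable.encode (m, (List.range l).map j)

/-- The node at level l remembers only the choices before l, so two branches still share a code at
the level where they first differ. -/
theorem branchCode_eq_iff {ι : Type*} [Encodable ι] {K : ℕ} {m m' : ι} {j j' : ℕ → ℕ} {l l' : ℕ} :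
    branchCode K m j l = branchCode K m' j' l' ↔ m = m' ∧ l = l' ∧ ∀ i < l, j i = j' i := by
  unfold branchCode
  rw [Nat.add_left_cancel_iff, Encodable.encode_inj, Prod.mk.injEq]
  refine and_congr_right fun _ => ⟨fun h => ?_, ?_⟩
  · have hl : l = l' := by simpa using congrArg List.length h
    subst hl
    exact ⟨rfl, by simpa using h⟩
  · rintro ⟨rfl, h⟩
    simpa using h

theorem lt_branchCode {ι : Type*} [Encodable ι] (K : ℕ) (m : ι) (j : ℕ → ℕ) (l : ℕ) :
    K < branchCode K m j l := by
  unfold branchCode; omega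

/-- The `l`-th functional along the branch `j` labelled by `m`. -/
def branchFunctional {𝕜 X ι : Type*} [RCLike 𝕜] [AddCommGroup X] [Module 𝕜 X] [Encodable ι]
    (f : ℕ → ℕ → X →ₗ[𝕜] 𝕜) (K : ℕ) (m : ι) (j : ℕ → ℕ) (l : ℕ) : X →ₗ[𝕜] 𝕜 :=
  f (branchCode K m j l) (j l)

/-- A sequence of vectors which follows a branch is almost biorthogonal to it, and almost
biorthogonal to any other branch up to the node where the two separate. -/
theorem exists_norm_branchFunctional_sub_le {𝕜 X ι : Type*} [RCLike 𝕜] [AddCommGroup X]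
    [Module 𝕜 X] [Encodable ι] {p : ℕ → Seminorm 𝕜 X} {f : ℕ → ℕ → X →ₗ[𝕜] 𝕜}
    (hf : ∀ k j x, ‖f k j x‖ ≤ p k x) {K : ℕ} {δ : ℝ} (hδ : 0 < δ) {m : ι} {j : ℕ → ℕ} {z : ℕ → X}
    (hz1 : ∀ l, p (branchCode K m j l) (z l) = 1)
    (hz : ∀ l i, K ≤ i → i ≠ branchCode K m j l → p i (z l) ≤ δ)
    (hfz : ∀ l, ‖branchFunctional f K m j l (z l) - 1‖ ≤ δ) (L : ℕ) (m' : ι) (j' : ℕ → ℕ) :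
    ∃ r, (m' = m → j' = j → r = L) ∧ (m' ≠ m → r = 0) ∧ ∀ l l', l < L → l' < L →
      ‖branchFunctional f K m' j' l' (z l) - (if l = l' ∧ l < r then 1 else 0)‖
        ≤ δ + if l = l' ∧ l = r then 1 else 0 := by
  have hsmall : ∀ l l', branchCode K m' j' l' ≠ branchCode K m j l →
      ‖branchFunctional f K m' j' l' (z l)‖ ≤ δ := fun l l' h =>
    (hf _ _ _).trans (hz _ _ (lt_branchCode K m' j' l').le h)
  have hnn : ∀ P : Prop, ∀ [Decidable P], (0 : ℝ) ≤ if P then 1 else 0 := by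
    intro P _; split_ifs <;> norm_num
  by_cases hm : m' = m
  · subst hm
    obtain ⟨r, hrL, hr, hr'⟩ : ∃ r, (j' = j → r = L) ∧ (∀ i < r, j' i = j i) ∧
        (r < L → j' r ≠ j r) := by
      classical
      by_cases h : ∃ i, j' i ≠ j i
      · refine ⟨Nat.find h, fun hj => ?_, fun i hi => not_not.1 (Nat.find_min h hi),
          fun _ => Nat.find_spec h⟩
        obtain ⟨i, hi⟩ := h
        exact absurd (congrFun hj i) hi
      · push Not at h
        exact ⟨L, fun _ => rfl, fun i _ => h i, fun h => absurd h (lt_irrefl _)⟩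
    refine ⟨r, fun _ => hrL, fun h => absurd rfl h, fun l l' hl hl' => ?_⟩
    by_cases hll : l = l'
    · subst hll
      rcases lt_trichotomy l r with h | h | h
      · have h1 : branchCode K m' j' l = branchCode K m' j l :=
          branchCode_eq_iff.2 ⟨rfl, rfl, fun i hi => hr i (hi.trans h)⟩
        have h2 : branchFunctional f K m' j' l = branchFunctional f K m' j l := by
          unfold branchFunctional
          rw [h1, hr l h]
        simp only [h, h.ne, true_and, if_true, if_false, add_zero, h2]
        exact hfz l
      -- At the separation node the norm is shared but the functional is not, so only the bound `p
      -- (z r) = 1` is available.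
      · simp only [h, lt_irrefl, and_false, if_false, sub_zero, and_self, if_true]
        have h1 : branchCode K m' j' r = branchCode K m' j r :=
          branchCode_eq_iff.2 ⟨rfl, rfl, hr⟩
        have h2 := hf (branchCode K m' j' r) (j' r) (z r)
        rw [h1, hz1 r, ← h1] at h2
        exact h2.trans (by linarith)
      · simp only [h.not_gt, h.ne', and_false, if_false, sub_zero, add_zero]
        refine hsmall _ _ fun hc => ?_
        exact hr' (h.trans hl) ((branchCode_eq_iff.1 hc).2.2 r h)
    · simp only [hll, false_and, if_false, sub_zero, add_zero]
      exact hsmall _ _ fun hc => hll (branchCode_eq_iff.1 hc).2.1.symm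
  · refine ⟨0, fun h => absurd h hm, fun _ => rfl, fun l l' _ _ => ?_⟩
    simp only [not_lt_zero, and_false, if_false, sub_zero]
    exact (hsmall l l' fun hc => hm (branchCode_eq_iff.1 hc).1).trans
      (le_add_of_nonneg_right (hnn _))

/-! ### Averaging over blocks of length N. -/

/-- The averages of `n` successive blocks of length `N` of a sequence. -/
noncomputable def blockAverage (𝕜 : Type*) {X : Type*} [RCLike 𝕜] [AddCommGroup X] [Module 𝕜 X]
    {n : ℕ} (N : ℕ) (z : ℕ → X) (i : Fin n) : X :=
  (N : 𝕜)⁻¹ • ∑ t : Fin N, z (finProdFinEquiv (i, t))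

/-- The sums of `n` successive blocks of length `N` of a sequence of functionals, as a map to
`𝕜ⁿ`. -/
def blockSum {𝕜 X : Type*} [RCLike 𝕜] [AddCommGroup X] [Module 𝕜 X]
    (n N : ℕ) (G : ℕ → X →ₗ[𝕜] 𝕜) : X →ₗ[𝕜] (Fin n → 𝕜) :=
  LinearMap.pi fun i => ∑ t : Fin N, G (finProdFinEquiv (i, t))

namespace Seminorm.IsNormalizedMonotone

variable {𝕜 : Type*} [RCLike 𝕜] {n : ℕ} {ν : Seminorm 𝕜 (Fin n → 𝕜)}

theorem map_average_truncation_le (hν : ν.IsNormalizedMonotone) {N : ℕ} (hN : 0 < N) (r : ℕ)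
    (a : Fin n → 𝕜) :
    ν (fun i => (N : 𝕜)⁻¹ * ∑ t : Fin N,
      if (finProdFinEquiv (i, t)).val < r then a i else 0) ≤ ν a := by
  have h : (fun i => (N : 𝕜)⁻¹ * ∑ t : Fin N,
      if (finProdFinEquiv (i, t)).val < r then a i else 0) = (N : 𝕜)⁻¹ • ∑ t : Fin N,
        fun i => if (finProdFinEquiv (i, t)).val < r then a i else 0 := by
    ext i; simp
  have hN' : (0 : ℝ) < N := Nat.cast_pos.2 hN
  rw [h, map_smul_eq_mul, norm_inv, RCLike.norm_natCast, inv_mul_le_iff₀ hN']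
  refine (Finset.le_sum_of_subadditive ν (map_zero ν).le (map_add_le_add ν) _ _).trans ?_
  have ht : ∀ t : Fin N,
      ν (fun i => if (finProdFinEquiv (i, t)).val < r then a i else 0) ≤ ν a := by
    intro t
    -- For fixed t the cut keeps an initial segment of the i's, of length the ceiling of (r - t)/N;
    -- truncated subtraction gives 0 when t ≥ r.
    have hm : ∀ i : Fin n,
        (finProdFinEquiv (i, t)).val < r ↔ i.val < (r - t + N - 1) / N := by
      intro i
      change _ ↔ i.val + 1 ≤ _
      rw [finProdFinEquiv_apply_val, Nat.le_div_iff_mul_le hN]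
      have : (i.val + 1) * N = N * i.val + N := by ring
      rw [this]
      dsimp only
      omega
    simp only [hm]
    exact hν.truncate a _
  refine (Finset.sum_le_sum fun t _ => ht t).trans ?_
  simp

/-- Almost biorthogonality of a sequence of functionals to a sequence of vectors, up to index `r`,
passes to sums and averages over successive blocks. -/
theorem map_blockSum_sub_le (hν : ν.IsNormalizedMonotone) {X : Type*} [AddCommGroup X]
    [Module 𝕜 X] {N : ℕ} (hN : 0 < N) {G : ℕ → X →ₗ[𝕜] 𝕜} {z : ℕ → X} {δ : ℝ} {r : ℕ}
    (h : ∀ l l', l < n * N → l' < n * N →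
      ‖G l' (z l) - (if l = l' ∧ l < r then 1 else 0)‖ ≤ δ + if l = l' ∧ l = r then 1 else 0)
    (a : Fin n → 𝕜) :
    ν (blockSum n N G (∑ i, a i • blockAverage 𝕜 N z i) - fun i => (N : 𝕜)⁻¹ * ∑ t : Fin N,
      if (finProdFinEquiv (i, t)).val < r then a i else 0) ≤ (n ^ 2 * N * δ + 1 / N) * ‖a‖ := by
  have hN' : (0 : ℝ) < N := Nat.cast_pos.2 hN
  let P := Fin n × Fin N
  let π : P → ℕ := fun s => (finProdFinEquiv s).val
  have hπ : ∀ s s', π s = π s' ↔ s = s' := fun s s' =>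
    ⟨fun h => finProdFinEquiv.injective (Fin.ext h), fun h => by rw [h]⟩
  have hterm : ∀ s : P, ‖G (π s) (∑ i, a i • blockAverage 𝕜 N z i)
      - (N : 𝕜)⁻¹ * (if π s < r then a s.1 else 0)‖
      ≤ (N : ℝ)⁻¹ * ‖a‖ * (n * N * δ + if π s = r then 1 else 0) := by
    intro s
    have e1 : G (π s) (∑ i, a i • blockAverage 𝕜 N z i)
        = ∑ s' : P, (N : 𝕜)⁻¹ * a s'.1 * G (π s) (z (π s')) := by
      simp only [blockAverage, map_sum, map_smul, smul_eq_mul, Fintype.sum_prod_type, P, π,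
        Finset.mul_sum]
      exact Finset.sum_congr rfl fun i _ => Finset.sum_congr rfl fun t _ => by ring
    have e2 : (N : 𝕜)⁻¹ * (if π s < r then a s.1 else 0)
        = ∑ s' : P, (N : 𝕜)⁻¹ * a s'.1 * (if π s' = π s ∧ π s' < r then 1 else 0) := by
      rw [Finset.sum_eq_single s]
      · simp
      · intro s' _ hs'
        rw [if_neg (fun hh => hs' ((hπ _ _).1 hh.1)), mul_zero]
      · simp
    rw [e1, e2, ← Finset.sum_sub_distrib]
    have e3 : ∀ s' : P, ‖(N : 𝕜)⁻¹ * a s'.1 * G (π s) (z (π s'))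
        - (N : 𝕜)⁻¹ * a s'.1 * (if π s' = π s ∧ π s' < r then 1 else 0)‖
        ≤ (N : ℝ)⁻¹ * ‖a‖ * (δ + if s' = s then (if π s = r then 1 else 0) else 0) := by
      intro s'
      rw [← mul_sub, norm_mul, norm_mul, norm_inv, RCLike.norm_natCast]
      have h1 := h (π s') (π s) (finProdFinEquiv s').isLt (finProdFinEquiv s).isLt
      have h2 : (if π s' = π s ∧ π s' = r then (1 : ℝ) else 0)
          = if s' = s then (if π s = r then 1 else 0) else 0 := by
        by_cases hs : s' = s
        · simp [hs]
        · simp [hs, hπ]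
      rw [h2] at h1
      have h3 : ‖a s'.1‖ ≤ ‖a‖ := norm_le_pi_norm a _
      gcongr
    refine (norm_sum_le_of_le _ fun s' _ => e3 s').trans (le_of_eq ?_)
    rw [← Finset.mul_sum, Finset.sum_add_distrib, Finset.sum_ite_eq' Finset.univ s]
    simp [P]
  refine (hν.le_sum _).trans ?_
  have hi : ∀ i : Fin n, ‖(blockSum n N G (∑ i, a i • blockAverage 𝕜 N z i) - fun i =>
      (N : 𝕜)⁻¹ * ∑ t : Fin N, if (finProdFinEquiv (i, t)).val < r then a i else 0) i‖
      ≤ ∑ t : Fin N, (N : ℝ)⁻¹ * ‖a‖ * (n * N * δ + if π (i, t) = r then 1 else 0) := by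
    intro i
    simp only [blockSum, Pi.sub_apply, LinearMap.pi_apply, LinearMap.sum_apply, Finset.mul_sum]
    rw [← Finset.sum_sub_distrib]
    exact norm_sum_le_of_le _ fun t _ => hterm (i, t)
  refine (Finset.sum_le_sum fun i _ => hi i).trans ?_
  rw [← Fintype.sum_prod_type
    (f := fun s : P => (N : ℝ)⁻¹ * ‖a‖ * (n * N * δ + if π s = r then 1 else 0)),
    ← Finset.mul_sum, Finset.sum_add_distrib]
  have hc : (∑ s : P, if π s = r then (1 : ℝ) else 0) ≤ 1 := by
    rw [Finset.sum_boole]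
    have : (Finset.univ.filter fun s : P => π s = r).card ≤ 1 :=
      Finset.card_le_one.2 fun s hs s' hs' =>
        (hπ _ _).1 ((Finset.mem_filter.1 hs).2.trans (Finset.mem_filter.1 hs').2.symm)
    exact_mod_cast this
  have hcard : (∑ _s : P, (n * N * δ : ℝ)) = n * N * (n * N * δ) := by simp [P]
  rw [hcard]
  calc (N : ℝ)⁻¹ * ‖a‖ * (n * N * (n * N * δ) + ∑ s : P, if π s = r then (1 : ℝ) else 0)
      ≤ (N : ℝ)⁻¹ * ‖a‖ * (n * N * (n * N * δ) + 1) := by gcongr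
    _ = (n ^ 2 * N * δ + 1 / N) * ‖a‖ := by field_simp

end Seminorm.IsNormalizedMonotone

/-! ### Branches followed by vectors, and normalized bases. -/

/-- A branch of the tree together with a sequence of successive finite linear combinations of `u`
that follows it. -/
theorem exists_branch {𝕜 X ι : Type*} [RCLike 𝕜] [NormedAddCommGroup X] [NormedSpace 𝕜 X]
    [Encodable ι] {p : ℕ → Seminorm 𝕜 X} {f : ℕ → ℕ → X →ₗ[𝕜] 𝕜}
    (hf : ∀ k z δ, 0 < δ → ∃ j, ‖f k j z - (p k z : 𝕜)‖ ≤ δ) {K : ℕ} {δ : ℝ} (hδ : 0 < δ)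
    {u : ℕ → X}
    (hu : ∀ k, K ≤ k → ∀ M, ∃ M' ≥ M, ∃ z ∈ Submodule.span 𝕜 (u '' Ico M M'), p k z = 1 ∧
      ∀ i, K ≤ i → i ≠ k → p i z ≤ δ) (m : ι) :
    ∃ (j : ℕ → ℕ) (z : ℕ → X) (M : ℕ → ℕ), Monotone M ∧
      (∀ l, z l ∈ Submodule.span 𝕜 (u '' Ico (M l) (M (l + 1)))) ∧
      (∀ l, p (branchCode K m j l) (z l) = 1) ∧
      (∀ l i, K ≤ i → i ≠ branchCode K m j l → p i (z l) ≤ δ) ∧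
      ∀ l, ‖branchFunctional f K m j l (z l) - 1‖ ≤ δ := by
  choose S hS Z hZ hZ1 hZs using fun s : List ℕ × ℕ =>
    hu (K + 1 + Encodable.encode (m, s.1)) (by omega) s.2
  choose J hJ using fun s : List ℕ × ℕ => hf (K + 1 + Encodable.encode (m, s.1)) (Z s) δ hδ
  -- The state holds the choices so far, which fix the next norm, and the first unused index of `u`;
  -- the vector is found first, then its functional.
  let st : ℕ → List ℕ × ℕ := fun l => Nat.rec ([], 0) (fun _ s => (s.1 ++ [J s], S s)) l
  have hst : ∀ l, (st l).1 = (List.range l).map fun i => J (st i) := by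
    intro l
    induction l with
    | zero => rfl
    | succ l ih =>
      rw [List.range_succ, List.map_append, ← ih]
      rfl
  have hcode : ∀ l, K + 1 + Encodable.encode (m, (st l).1)
      = branchCode K m (fun i => J (st i)) l := fun l => by rw [hst l]; rfl
  refine ⟨fun l => J (st l), fun l => Z (st l), fun l => (st l).2,
    monotone_nat_of_le_succ fun l => hS (st l), fun l => hZ (st l), fun l => ?_, fun l => ?_,
    fun l => ?_⟩
  · rw [← hcode]; exact hZ1 _
  · rw [← hcode]; exact hZs _
  · have := hJ (st l)
    rw [hZ1, RCLike.ofReal_one] at this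
    rw [branchFunctional, ← hcode]
    exact this

/-- The normalization of a monotone basis, as a seminorm on `𝕜ⁿ`. -/
theorem IsMonotoneBasis.exists_isNormalizedMonotone {𝕜 F : Type*} [RCLike 𝕜]
    [NormedAddCommGroup F] [NormedSpace 𝕜 F] {n : ℕ} {y : Module.Basis (Fin n) 𝕜 F}
    (hy : IsMonotoneBasis y) :
    ∃ ν : Seminorm 𝕜 (Fin n → 𝕜), ν.IsNormalizedMonotone ∧
      ∀ a : Fin n → 𝕜, ν (fun i => a i * (‖y i‖ : 𝕜)) = ‖∑ i, a i • y i‖ := by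
  have h0 : ∀ i, (‖y i‖ : 𝕜) ≠ 0 := fun i => by
    simpa using y.ne_zero i
  refine ⟨(normSeminorm 𝕜 F).comp
    (Fintype.linearCombination 𝕜 fun i => (‖y i‖ : 𝕜)⁻¹ • y i), ⟨fun i => ?_, fun a m => ?_⟩,
    fun a => ?_⟩
  · have := norm_ne_zero_iff.2 (y.ne_zero i)
    simp [norm_smul, this]
  · have := hy (fun i => a i * (‖y i‖ : 𝕜)⁻¹) m
    simpa [Fintype.linearCombination_apply, smul_smul, Finset.sum_filter, ite_smul] using this
  · simp only [Seminorm.comp_apply, coe_normSeminorm, Fintype.linearCombination_apply, smul_smul]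
    congr 1
    exact Finset.sum_congr rfl fun i _ => by rw [mul_assoc, mul_inv_cancel₀ (h0 i), mul_one]

theorem norm_blockSum_apply_le {𝕜 X : Type*} [RCLike 𝕜] [NormedAddCommGroup X] [NormedSpace 𝕜 X]
    {n N : ℕ} {G : ℕ → X →ₗ[𝕜] 𝕜} (hG : ∀ l x, ‖G l x‖ ≤ ‖x‖) {ν : Seminorm 𝕜 (Fin n → 𝕜)}
    (hν : ν.IsNormalizedMonotone) (x : X) : ν (blockSum n N G x) ≤ n * N * ‖x‖ := by
  refine (hν.le_sum _).trans ?_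
  have : ∀ i : Fin n, ‖blockSum n N G x i‖ ≤ N * ‖x‖ := fun i => by
    simp only [blockSum, LinearMap.pi_apply, LinearMap.sum_apply]
    refine (norm_sum_le_of_le _ fun t _ => hG _ x).trans ?_
    simp
  refine (Finset.sum_le_sum fun i _ => this i).trans ?_
  simp [mul_assoc]

/-! ### Construction of the norm and the final estimate. -/

theorem theorem3p1 {𝕜 : Type*} [RCLike 𝕜] {X : Type*} [NormedAddCommGroup X] [NormedSpace 𝕜 X]
    [CompleteSpace X] (hX : SequentiallyArbitrarilyDistortable 𝕜 X) (e : SchauderBasis 𝕜 X)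
    (n : ℕ) (ε : ℝ) (hε : 0 < ε) :
    ∃ q : Seminorm 𝕜 X, IsEquivalentNorm q ∧
      ∀ (F : Type*) [NormedAddCommGroup F] [NormedSpace 𝕜 F] (y : Module.Basis (Fin n) 𝕜 F),
        IsMonotoneBasis y →
        ∀ u : ℕ → X, IsBlockBasis 𝕜 e.basis u →
          ∃ x : Fin n → X, IsBlockBasis 𝕜 u x ∧ AreEquivalentWithConstant (1 + ε) q x y := by
  obtain ⟨p, θ, hpe, hθ, hθ0, hp, hY⟩ := hX
  have := e.separableSpace
  obtain ⟨f, hf, hfn⟩ := exists_norming_sequence p hp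
  obtain ⟨T, hTc, hT, hTd⟩ := Seminorm.IsNormalizedMonotone.exists_countable_dense 𝕜 n
  let : Encodable T := hTc.toEncodable
  -- Chosen so that (1 + τ)/(1 - τ) = 1 + ε.
  set τ := ε / (2 + ε) with hτ
  have hτ0 : 0 < τ := by positivity
  have hτ1 : τ < 1 := by rw [hτ, div_lt_one (by positivity)]; linarith
  set η := τ / 8 with hη
  have hη0 : 0 < η := by positivity
  obtain ⟨N, hN⟩ := exists_nat_gt (1 / η)
  have hN0' : (0 : ℝ) < N := (by positivity : (0 : ℝ) < 1 / η).trans hN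
  have hN0 : 0 < N := Nat.cast_pos.1 hN0'
  have hNη : 1 / (N : ℝ) ≤ η := by
    rw [one_div_le hN0' hη0]; exact hN.le
  obtain ⟨δ, hδ0, hδ⟩ : ∃ δ : ℝ, 0 < δ ∧ n ^ 2 * N * δ + n * δ ≤ η := by
    refine ⟨η / (n ^ 2 * N + n + 1), by positivity, ?_⟩
    rw [← add_mul, mul_div_assoc', div_le_iff₀ (by positivity)]
    nlinarith
  obtain ⟨K, hK⟩ := ((tendsto_order.1 hθ0).2 (δ / 4) (by positivity)).exists
  let Ψ : T × (ℕ → ℕ) → Seminorm 𝕜 X := fun s =>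
    s.1.1.comp (blockSum n N (branchFunctional f K s.1 s.2))
  have hΨ : ∀ s x, Ψ s x ≤ n * N * ‖x‖ := fun s x =>
    norm_blockSum_apply_le (fun l x => (hf _ _ x).trans (hp _ x)) (hT _ s.1.2) x
  have hbdd' : ∀ x, BddAbove (range fun s => Ψ s x) := fun x =>
    ⟨n * N * ‖x‖, by rintro _ ⟨s, rfl⟩; exact hΨ s x⟩
  have hbdd : BddAbove (range Ψ) := Seminorm.bddAbove_range_iff.2 hbdd'
  have hq : ∀ x, (p K + ⨆ s, Ψ s) x = p K x + ⨆ s, Ψ s x := fun x => by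
    rw [add_apply, Seminorm.iSup_apply hbdd]
  -- `p K` supplies the lower bound of an equivalent norm; every code exceeds K, so it stays small
  -- on the chosen vectors.
  refine ⟨p K + ⨆ s, Ψ s, ?_, ?_⟩
  · obtain ⟨c, C, hc, -, hcC⟩ := hpe K
    refine ⟨c, 1 + n * N, hc, by positivity, fun x => ?_⟩
    rw [hq]
    have h1 : 0 ≤ ⨆ s, Ψ s x := Real.iSup_nonneg fun s => apply_nonneg _ _
    have h2 : ⨆ s, Ψ s x ≤ n * N * ‖x‖ := Real.iSup_le (fun s => hΨ s x) (by positivity)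
    exact ⟨by linarith [(hcC x).1], by linarith [hp K x]⟩
  · intro F _ _ y hy u hu
    obtain ⟨ν, hν, hνy⟩ := hy.exists_isNormalizedMonotone
    obtain ⟨μ, hμT, hμ⟩ := hTd ν hν η hη0
    obtain ⟨j, z, M, hM, hzM, hz1, hzs, hzf⟩ := exists_branch (ι := T) hfn hδ0
      (exists_finite_combination_small hθ hp hY (hu.linearIndependent e.linearIndependent) hδ0
        hK.le) ⟨μ, hμT⟩
    have hest : ∀ b : Fin n → 𝕜,
        |(p K + ⨆ s, Ψ s) (∑ i, b i • blockAverage 𝕜 N z i) - ν b| ≤ τ * ν b := by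
      intro b
      set w := ∑ i, b i • blockAverage 𝕜 N z i with hw
      have hμ0 := hT μ hμT
      have hupper : ∀ s, Ψ s w ≤ μ b + (n ^ 2 * N * δ + 1 / N) * ‖b‖ := by
        rintro ⟨m', j'⟩
        obtain ⟨r, -, hr0, h⟩ := exists_norm_branchFunctional_sub_le hf hδ0 hz1 hzs hzf (n * N) m' j'
        have h1 := (hT _ m'.2).map_blockSum_sub_le hN0 h b
        rw [← hw] at h1
        refine (le_map_add_map_sub m'.1 _ _).trans (add_le_add ?_ h1)
        by_cases hm : m' = ⟨μ, hμT⟩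
        · rw [hm]
          exact hμ0.map_average_truncation_le hN0 r b
        · rw [hr0 hm]
          have h0 : (fun i : Fin n => (N : 𝕜)⁻¹ * ∑ t : Fin N,
              if (finProdFinEquiv (i, t)).val < 0 then b i else 0) = 0 := by
            ext i; simp
          rw [h0, map_zero]
          exact apply_nonneg _ _
      have hlower : μ b - (n ^ 2 * N * δ + 1 / N) * ‖b‖ ≤ Ψ (⟨μ, hμT⟩, j) w := by
        obtain ⟨r, hr, -, h⟩ := exists_norm_branchFunctional_sub_le hf hδ0 hz1 hzs hzf (n * N)
          (⟨μ, hμT⟩ : T) j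
        have hrr := hr rfl rfl
        have h1 := hμ0.map_blockSum_sub_le hN0 h b
        have h2 : (fun i : Fin n => (N : 𝕜)⁻¹ * ∑ t : Fin N,
            if (finProdFinEquiv (i, t)).val < r then b i else 0) = b := by
          ext i
          have hN𝕜 : (N : 𝕜) ≠ 0 := Nat.cast_ne_zero.2 hN0.ne'
          have hlt : ∀ t : Fin N, (finProdFinEquiv (i, t)).val < r := fun t =>
            hrr ▸ (finProdFinEquiv (i, t)).isLt
          simp only [hlt, if_true]
          simp [hN𝕜]
        rw [h2, ← hw] at h1
        have h3 := le_map_add_map_sub μ b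
          (blockSum n N (branchFunctional f K (⟨μ, hμT⟩ : T) j) w)
        rw [map_sub_rev] at h3
        simp only [Ψ, Seminorm.comp_apply]
        linarith
      have hpK : p K w ≤ n * δ * ‖b‖ := by
        have h1 : ∀ i : Fin n, p K (blockAverage 𝕜 N z i) ≤ δ := by
          intro i
          rw [blockAverage, map_smul_eq_mul, norm_inv, RCLike.norm_natCast, inv_mul_le_iff₀ hN0']
          refine (Finset.le_sum_of_subadditive (p K) (map_zero _).le (map_add_le_add _) _ _).trans ?_
          refine (Finset.sum_le_sum fun t _ =>
            hzs _ K le_rfl (lt_branchCode K _ _ _).ne).trans ?_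
          simp
        refine (Finset.le_sum_of_subadditive (p K) (map_zero _).le (map_add_le_add _) _ _).trans ?_
        have h2 : ∀ i : Fin n, p K (b i • blockAverage 𝕜 N z i) ≤ ‖b‖ * δ := by
          intro i
          rw [map_smul_eq_mul]
          exact mul_le_mul (norm_le_pi_norm b i) (h1 i) (apply_nonneg _ _) (norm_nonneg _)
        refine (Finset.sum_le_sum fun i _ => h2 i).trans (le_of_eq ?_)
        simp only [Finset.sum_const, Finset.card_univ, Fintype.card_fin, nsmul_eq_mul]
        ring
      have hsup : ⨆ s, Ψ s w ≤ μ b + (n ^ 2 * N * δ + 1 / N) * ‖b‖ :=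
        Real.iSup_le hupper (by positivity)
      have hinf : Ψ (⟨μ, hμT⟩, j) w ≤ ⨆ s, Ψ s w := le_ciSup (hbdd' w) _
      have hb0 := norm_nonneg b
      have hb := hν.norm_le b
      have h1 := abs_le.1 (hμ b)
      have h2 : (n ^ 2 * N * δ + n * δ) * ‖b‖ ≤ η * ‖b‖ := by gcongr
      have h3 : 1 / (N : ℝ) * ‖b‖ ≤ η * ‖b‖ := by gcongr
      have h4 : η * ‖b‖ ≤ η * (2 * ν b) := by gcongr
      have h5 : 0 ≤ n * δ * ‖b‖ := by positivity
      have h6 := apply_nonneg (p K) w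
      have h7 : τ * ν b = 8 * (η * ν b) := by rw [hη]; ring
      have h8 : 0 ≤ η * ν b := mul_nonneg hη0.le (apply_nonneg _ _)
      rw [hq, abs_le, h7]
      constructor <;> linarith
    have hequiv : AreEquivalentWithConstant (1 + ε) (p K + ⨆ s, Ψ s)
        (fun i => (‖y i‖ : 𝕜) • blockAverage 𝕜 N z i) y := by
      refine ⟨1 / (1 - τ), 1 + τ, by simpa using hτ1, by positivity, ?_, fun a => ?_⟩
      · rw [one_div_mul_eq_div, div_le_iff₀ (by linarith)]
        have : τ * (2 + ε) = ε := by rw [hτ]; field_simp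
        linarith
      · have h := abs_le.1 (hest fun i => a i * (‖y i‖ : 𝕜))
        rw [hνy] at h
        simp only [smul_smul]
        refine ⟨?_, by linarith [h.2]⟩
        rw [one_div_mul_eq_div, le_div_iff₀ (by linarith)]
        linarith [h.1]
    -- The i-th average uses z_l for N i ≤ l < N (i + 1).
    refine ⟨_, ⟨fun i => Finset.Ico (M (N * i)) (M (N * (i + 1))), ?_, fun i => ⟨?_, ?_⟩⟩, hequiv⟩
    · intro i k hik a ha b hb
      rw [Finset.mem_Ico] at ha hb
      have : M (N * (i + 1)) ≤ M (N * k) := hM (Nat.mul_le_mul_left _ (Fin.lt_def.1 hik))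
      omega
    · intro h0
      obtain ⟨A, B, -, -, -, hAB⟩ := hequiv
      have := (hAB (Pi.single i 1)).1
      simp only [Pi.single_apply, ite_smul, one_smul, zero_smul, Finset.sum_ite_eq',
        Finset.mem_univ, if_true, h0, map_zero, mul_zero, norm_le_zero_iff] at this
      exact y.ne_zero i this
    · refine Submodule.smul_mem _ _ (Submodule.smul_mem _ _ (Submodule.sum_mem _ fun t _ => ?_))
      refine Submodule.span_mono (image_mono ?_) (hzM _)
      rw [Finset.coe_Ico, finProdFinEquiv_apply_val]
      refine Ico_subset_Ico (hM (Nat.le_add_left _ _)) (hM ?_)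
      have := t.isLt
      dsimp only
      rw [mul_add, mul_one]
      omega
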